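/- Setting. There are $n$ buyers with values $v_1,\dots,v_n\in[0,1]$ and $n$ sellers with costs $c_1,\dots,c_n\in[0,1]$. The values are i.i.d. from a distribution $F$ on $[0,1]$ and, independently, the costs are i.i.d. from a distribution $G$ on $[0,1]$. A mechanism maps bids $b\in[0,1]^n$ and asks $a\in[0,1]^n$ to an allocation $x(b,a)\in[0,1]$ (shared by all agents), a payment $p(b,a)\in\mathbb{R}$ shared by all buyers and a receipt $r(b,a)\in\mathbb{R}$ shared by all sellers. It is deterministic if $x(b,a)\in\{0,1\}$ always. Buyer $i$ has utility $x(b,a)\,v_i-p(b,a)$ and seller $j$ has utility $r(b,a)-x(b,a)\,c_j$. The mechanism is incentive compatible (IC) if, whatever the others report, each agent's truthful report maximizes that agent's utility over all reports in $[0,1]$, and among all reports that attain the maximal utility it has the largest $x$ (ties are broken in favor of trade). Let $$\mathrm{ALG}=\mathbb{E}\Big[\Big(\sum_i v_i-\sum_j c_j\Big)x(v,c)\Big],\qquad \mathrm{FB}=\mathbb{E}\Big[\Big(\sum_i v_i-\sum_j c_j\Big)\mathbf{1}\Big\{\sum_i v_i\ge\sum_j c_j\Big\}\Big].$$ A family of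 mechanisms, one for each $n$, is efficient in the limit for $(F,G)$ if $\mathrm{ALG}/\mathrm{FB}\to 1$ as $n\to\infty$. Theorem. In the case $\mathbb{E}_F[v]\le\mathbb{E}_G[c]$, IC deterministic mechanisms cannot in general be efficient in the limit: there are distributions $F,G$ on $[0,1]$ with $\mathbb{E}_F[v]\le\mathbb{E}_G[c]$ and $\mathrm{FB}>0$ for all $n\ge1$ for which no family of IC deterministic mechanisms, even one chosen with knowledge of $F$ and $G$, is efficient in the limit. In fact, this holds for $F$ uniform on $[0,1]$ and $G$ the point mass at $1/2$ (both of mean $1/2$, with $\mathrm{FB}>0$ for all $n\ge 1$): for these, the gain of every IC deterministic mechanism is integrable, and for every $\varepsilon>0$ there is an $N$ such that for all $n\ge N$ every IC deterministic mechanism with $n$ buyers and $n$ sellers satisfies $$\frac{\mathrm{ALG}}{\mathrm{FB}}\le\frac{\sqrt3}{2}+\varepsilon .$$ -/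

import Mathlib

open MeasureTheory Filter Topology unitInterval

noncomputable section

namespace MBT

/-- A trading mechanism for `n` buyers and `n` sellers whose values, costs, bids and asks all lie in
`[0,1]`. For a bid vector `b` and an ask vector `a`, `x b a` is the probability of trading, shared by
all agents, `p b a` is the payment shared by all buyers, and `r b a` is the receipt shared by all
sellers. -/
structure Mechanism (n : ℕ) where
  x : (Fin n → I) → (Fin n → I) → ℝ
  p : (Fin n → I) → (Fin n → I) → ℝ
  r : (Fin n → I) → (Fin n → I) → ℝ
  x_nonneg : ∀ b a, 0 ≤ x b a
  x_le_one : ∀ b a, x b a ≤ 1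

namespace Mechanism

variable {n : ℕ}

/-- The allocation is always `0` or `1`. -/
def IsDeterministic (M : Mechanism n) : Prop :=
  ∀ b a, M.x b a = 0 ∨ M.x b a = 1

/-- Quasilinear utility of a buyer with value `v`. -/
def buyerUtility (M : Mechanism n) (v : I) (b a : Fin n → I) : ℝ :=
  M.x b a * (v : ℝ) - M.p b a

/-- Quasilinear utility of a seller with cost `c`. -/
def sellerUtility (M : Mechanism n) (c : I) (b a : Fin n → I) : ℝ :=
  M.r b a - M.x b a * (c : ℝ)

/-- Incentive compatibility: whatever the other agents report, an agent's truthful report yields an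
outcome that the agent weakly prefers to the outcome of every other report. Preferences are given by
utility, and between outcomes of equal utility the one with the larger `x` is preferred.
The truthful report of buyer `i` is written `b i` (of seller `j`, `a j`), and the other entries of
`b` and `a` are arbitrary reports. -/
def IsIC (M : Mechanism n) : Prop :=
  (∀ (b a : Fin n → I) (i : Fin n) (z : I),
    M.buyerUtility (b i) (Function.update b i z) a ≤ M.buyerUtility (b i) b a ∧
    (M.buyerUtility (b i) (Function.update b i z) a = M.buyerUtility (b i) b a →
      M.x (Function.update b i z) a ≤ M.x b a)) ∧
  (∀ (b a : Fin n → I) (j : Fin n) (z : I),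
    M.sellerUtility (a j) b (Function.update a j z) ≤ M.sellerUtility (a j) b a ∧
    (M.sellerUtility (a j) b (Function.update a j z) = M.sellerUtility (a j) b a →
      M.x b (Function.update a j z) ≤ M.x b a))

end Mechanism

/-- The joint law of values and costs: `n` i.i.d. values from `F`, and independently `n` i.i.d. costs
from `G`. -/
def jointLaw (F G : Measure I) (n : ℕ) : Measure ((Fin n → I) × (Fin n → I)) :=
  (Measure.pi fun _ : Fin n => F).prod (Measure.pi fun _ : Fin n => G)

/-- Total value minus total cost. -/
def surplus {n : ℕ} (v c : Fin n → I) : ℝ :=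
  (∑ i, (v i : ℝ)) - ∑ j, (c j : ℝ)

/-- Realized gain from trade under truthful reports, as a function of the values and costs. -/
def Mechanism.gain {n : ℕ} (M : Mechanism n) (w : (Fin n → I) × (Fin n → I)) : ℝ :=
  surplus w.1 w.2 * M.x w.1 w.2

/-- Expected gains from trade of a mechanism under truthful reports. -/
def Mechanism.gft {n : ℕ} (M : Mechanism n) (F G : Measure I) : ℝ :=
  ∫ w, M.gain w ∂(jointLaw F G n)

/-- The first best: trade exactly when the total value is at least the total cost. -/
def firstBest (F G : Measure I) (n : ℕ) : ℝ :=
  ∫ w : (Fin n → I) × (Fin n → I),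
    surplus w.1 w.2 * (if ∑ j, (w.2 j : ℝ) ≤ ∑ i, (w.1 i : ℝ) then 1 else 0) ∂(jointLaw F G n)

/-- A family of mechanisms, one for each number of agents, is efficient in the limit when the ratio
of its gains from trade to the first best tends to `1`. -/
def EfficientInLimit (F G : Measure I) (M : (n : ℕ) → Mechanism n) : Prop :=
  Tendsto (fun n => (M n).gft F G / firstBest F G n) atTop (𝓝 1)

/-- The mean of a distribution on `[0,1]`. -/
def mean (F : Measure I) : ℝ := ∫ t, (t : ℝ) ∂F

/-- The uniform distribution on `[0,1]`. -/
def uniformPrior : Measure I := volume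

/-- The point mass at `1/2`. -/
def halfPrior : Measure I := Measure.dirac ⟨1 / 2, by norm_num, by norm_num⟩

end MBT

end

/-!
The point mass prior makes every cost `1 / 2`, so only the allocation against the constant asks
`1 / 2` matters, and only the buyers' incentives are used.

*Deterministic mechanisms.* Along a change of one bid, incentive compatibility makes the allocation
monotone and lets the payment depend on the bid only through the allocation. Any profile without
trade can be lowered to the zero profile without ever trading, and any profile with trade can be
raised to the profile of ones while trading throughout, so the common payment takes one value
without trade and one value with trade. Their difference `t` is a price shared by all pivotal
buyers, and the allocation depends on the bids only through the set `S` of buyers with bid at least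
`t` (`Mechanism.IsIC.exists_price`).

*Upper bound.* Given `S`, uniform values have conditional mean surplus `(|S| - n (1 - t)) / 2`
(`setIntegral_priceBox`), so the mechanism gains at most half the mean positive part of a centred
binomial variable. De Moivre's closed formula for this mean (`sum_Icc_binomial_deviation`),
maximised over the success probability and estimated by Stirling's formula, bounds the gain
uniformly in `t` by a quantity asymptotic to `√n / (4 √(2 π))` (`integral_sum_sub_half_mul_le`).

*Lower bound.* The first best is the mean positive part of a centred sum of `n` uniform variables,
each of variance `1 / 12`. By the central limit theorem and Fatou's lemma for weak convergence it
is at least asymptotic to `√(n / 12) / √(2 π)` (`eventually_lt_firstBest`).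

The quotient of the two is `√12 / 4 = √3 / 2`: conditioning on the sets `{v i ≥ t}` reduces the
variance of a value from `1 / 12` to at most `1 / 16`.
-/

/-! ### Deterministic incentive compatible mechanisms use a common posted price -/

namespace MBT

/-- A predicate on profiles that survives lowering a single coordinate survives lowering all of
them. -/
theorem of_le_of_update {n : ℕ} {P : (Fin n → I) → Prop}
    (hP : ∀ (b : Fin n → I) (i : Fin n) (z : I), z ≤ b i → P b → P (Function.update b i z))
    {b b' : Fin n → I} (hle : b' ≤ b) (hb : P b) : P b' := by
  have key : ∀ s : Finset (Fin n), P (s.piecewise b' b) := by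
    intro s
    induction s using Finset.induction_on with
    | empty => simpa using hb
    | insert j s hj ih =>
      rw [Finset.piecewise_insert]
      exact hP _ _ _ (by simpa [hj] using hle j) ih
  simpa using key Finset.univ

/-- The upward analogue of `of_le_of_update`. -/
theorem of_ge_of_update {n : ℕ} {P : (Fin n → I) → Prop}
    (hP : ∀ (b : Fin n → I) (i : Fin n) (z : I), b i ≤ z → P b → P (Function.update b i z))
    {b b' : Fin n → I} (hle : b ≤ b') (hb : P b) : P b' := by
  have key : ∀ s : Finset (Fin n), P (s.piecewise b' b) := by
    intro s
    induction s using Finset.induction_on with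
    | empty => simpa using hb
    | insert j s hj ih =>
      rw [Finset.piecewise_insert]
      exact hP _ _ _ (by simpa [hj] using hle j) ih
  simpa using key Finset.univ

namespace Mechanism

variable {n : ℕ} {M : Mechanism n}

/-- A buyer with value `z` weakly prefers reporting `z` to reporting `b i`. -/
theorem IsIC.buyerUtility_le_update (hIC : M.IsIC) (b a : Fin n → I) (i : Fin n) (z : I) :
    M.buyerUtility z b a ≤ M.buyerUtility z (Function.update b i z) a ∧
    (M.buyerUtility z b a = M.buyerUtility z (Function.update b i z) a →
      M.x b a ≤ M.x (Function.update b i z) a) := by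
  simpa using hIC.1 (Function.update b i z) a i (b i)

theorem IsIC.x_update_le (hIC : M.IsIC) {b a : Fin n → I} {i : Fin n} {z : I} (hz : z ≤ b i) :
    M.x (Function.update b i z) a ≤ M.x b a := by
  rcases hz.eq_or_lt with rfl | hlt
  · simp
  have h1 := (hIC.1 b a i z).1
  have h2 := (hIC.buyerUtility_le_update b a i z).1
  simp only [buyerUtility] at h1 h2
  have hlt' : (z : ℝ) < b i := hlt
  by_contra! hcon
  nlinarith

theorem IsIC.le_x_update (hIC : M.IsIC) {b a : Fin n → I} {i : Fin n} {z : I} (hz : b i ≤ z) :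
    M.x b a ≤ M.x (Function.update b i z) a := by
  simpa using hIC.x_update_le (b := Function.update b i z) (a := a) (i := i) (z := b i)
    (by simpa using hz)

/-- A buyer's report affects the payment only through the allocation. -/
theorem IsIC.p_update_eq (hIC : M.IsIC) {b a : Fin n → I} {i : Fin n} {z : I}
    (hx : M.x (Function.update b i z) a = M.x b a) :
    M.p (Function.update b i z) a = M.p b a := by
  have h1 := (hIC.1 b a i z).1
  have h2 := (hIC.buyerUtility_le_update b a i z).1
  simp only [buyerUtility, hx] at h1 h2
  linarith

/-- The payment is the same at all profiles without trade: any of them can be lowered to the zero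
profile one coordinate at a time, without ever trading. -/
theorem IsIC.p_eq_of_x_eq_zero (hIC : M.IsIC) {b a : Fin n → I} (hx : M.x b a = 0) :
    M.p b a = M.p 0 a := by
  have := of_le_of_update (P := fun b' => M.x b' a = 0 ∧ M.p b' a = M.p b a) (b := b) (b' := 0)
    (fun b' i z hz h => by
      have hx' : M.x (Function.update b' i z) a = 0 :=
        le_antisymm ((hIC.x_update_le hz).trans h.1.le) (M.x_nonneg _ _)
      exact ⟨hx', (hIC.p_update_eq (hx'.trans h.1.symm)).trans h.2⟩)
    (fun i => unitInterval.nonneg') ⟨hx, rfl⟩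
  exact this.2.symm

/-- The payment is the same at all profiles with trade: any of them can be raised to the profile of
ones, always trading. -/
theorem IsIC.p_eq_of_x_eq_one (hIC : M.IsIC) {b a : Fin n → I} (hx : M.x b a = 1) :
    M.p b a = M.p 1 a := by
  have := of_ge_of_update (P := fun b' => M.x b' a = 1 ∧ M.p b' a = M.p b a) (b := b) (b' := 1)
    (fun b' i z hz h => by
      have hx' : M.x (Function.update b' i z) a = 1 :=
        le_antisymm (M.x_le_one _ _) (h.1.ge.trans (hIC.le_x_update hz))
      exact ⟨hx', (hIC.p_update_eq (hx'.trans h.1.symm)).trans h.2⟩)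
    (fun i => unitInterval.le_one') ⟨hx, rfl⟩
  exact this.2.symm

/-- Changing one bid without crossing the price `p 1 a - p 0 a` does not change the allocation. -/
theorem IsIC.x_update_eq (hIC : M.IsIC) (hdet : M.IsDeterministic) {b a : Fin n → I} {i : Fin n}
    {z : I} (hiff : M.p 1 a - M.p 0 a ≤ b i ↔ M.p 1 a - M.p 0 a ≤ z) :
    M.x (Function.update b i z) a = M.x b a := by
  wlog hz : z ≤ b i generalizing b z
  · simpa using (this (b := Function.update b i z) (z := b i) (by simpa using hiff.symm)
      (by simpa using (le_of_not_ge hz))).symm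
  have hle := hIC.x_update_le (a := a) hz
  rcases hdet b a with h0 | h1
  · exact le_antisymm hle (h0.le.trans (M.x_nonneg _ _))
  rcases hdet (Function.update b i z) a with h0' | h1'
  · -- If the allocation switched, `b i` would accept the price while tie-breaking makes `z`
    -- reject it strictly.
    exfalso
    have hu := (hIC.1 b a i z).1
    have hv := hIC.buyerUtility_le_update b a i z
    simp only [buyerUtility, h1, h0', hIC.p_eq_of_x_eq_zero h0', hIC.p_eq_of_x_eq_one h1]
      at hu hv
    have hpz := hiff.1 (by linarith)
    have := hv.2 (by linarith [hv.1])
    linarith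
  · rw [h1, h1']

/-- Against fixed asks, the allocation of a deterministic incentive compatible mechanism depends
only on which bids reach a price `t` common to all buyers. -/
theorem IsIC.exists_price (hIC : M.IsIC) (hdet : M.IsDeterministic) (a : Fin n → I) :
    ∃ t : I, ∀ b b' : Fin n → I, (∀ i, t ≤ b i ↔ t ≤ b' i) → M.x b a = M.x b' a := by
  have key : ∀ b b' : Fin n → I,
      (∀ i, M.p 1 a - M.p 0 a ≤ b i ↔ M.p 1 a - M.p 0 a ≤ b' i) → M.x b a = M.x b' a := by
    intro b b' h
    have hs : ∀ s : Finset (Fin n), M.x (s.piecewise b' b) a = M.x b a := by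
      intro s
      induction s using Finset.induction_on with
      | empty => simp
      | insert j s hj ih =>
        rw [Finset.piecewise_insert, hIC.x_update_eq hdet (by simpa [hj] using h j), ih]
    simpa using (hs Finset.univ).symm
  by_cases ht : M.p 1 a - M.p 0 a ∈ I
  · exact ⟨⟨_, ht⟩, fun b b' h => key b b' h⟩
  · -- A price outside the unit interval is reached by all bids or by none.
    refine ⟨0, fun b b' _ => key b b' fun i => ?_⟩
    rcases lt_or_ge (M.p 1 a - M.p 0 a) 0 with hneg | hpos
    · exact iff_of_true (hneg.le.trans (b i).2.1) (hneg.le.trans (b' i).2.1)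
    · have hgt : 1 < M.p 1 a - M.p 0 a := by
        by_contra! hle
        exact ht ⟨hpos, hle⟩
      exact iff_of_false (fun h => (hgt.trans_le h).not_ge (b i).2.2)
        (fun h => (hgt.trans_le h).not_ge (b' i).2.2)

end Mechanism

end MBT

/-! ### The mean deviation of the binomial distribution -/

namespace MBT

/-- De Moivre's formula for the upper partial first moment of a centred binomial distribution. -/
theorem sum_Icc_binomial_deviation (n : ℕ) (q : ℝ) {m : ℕ} (hm : m ≤ n) :
    ∑ k ∈ Finset.Icc m n, (n.choose k : ℝ) * (q ^ k * (1 - q) ^ (n - k) * (k - n * q)) =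
      m * n.choose m * q ^ m * (1 - q) ^ (n + 1 - m) := by
  induction hm using Nat.decreasingInduction with
  | self => simp; ring
  | of_succ m hm ih =>
    have hins : Finset.Icc m n = insert m (Finset.Icc (m + 1) n) := by
      ext j; simp only [Finset.mem_insert, Finset.mem_Icc]; omega
    rw [hins, Finset.sum_insert (by simp), ih]
    have hch : ((m + 1 : ℕ) : ℝ) * n.choose (m + 1) = n.choose m * (n - m) := by
      have := Nat.choose_succ_right_eq n m
      rw [← Nat.cast_sub hm.le]
      exact_mod_cast (mul_comm _ _).trans this
    rw [hch, show n + 1 - (m + 1) = n - m by omega, show n + 1 - m = (n - m) + 1 by omega]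
    ring

/-- The function `q ^ j * (1 - q) ^ k` is maximal at `q = j / (j + k)`. -/
theorem pow_mul_one_sub_pow_le {q : ℝ} (h0 : 0 ≤ q) (h1 : q ≤ 1) {j k : ℕ} (hj : 0 < j)
    (hk : 0 < k) :
    q ^ j * (1 - q) ^ k ≤ (j / (j + k : ℝ)) ^ j * (k / (j + k : ℝ)) ^ k := by
  have hj' : (0 : ℝ) < j := by exact_mod_cast hj
  have hk' : (0 : ℝ) < k := by exact_mod_cast hk
  set a : ℝ := j / (j + k : ℝ) with ha
  set b : ℝ := k / (j + k : ℝ) with hb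
  have ha0 : 0 < a := by positivity
  have hb0 : 0 < b := by positivity
  have hab : a + b = 1 := by rw [ha, hb]; field_simp
  have hqa : 0 ≤ q / a := by positivity
  have hqb : 0 ≤ (1 - q) / b := div_nonneg (by linarith) hb0.le
  have h := Real.geom_mean_le_arith_mean2_weighted ha0.le hb0.le hqa hqb hab
  rw [mul_div_cancel₀ _ ha0.ne', mul_div_cancel₀ _ hb0.ne', add_sub_cancel] at h
  have h' := pow_le_one₀ (n := j + k) (by positivity) h
  rw [mul_pow, ← Real.rpow_mul_natCast hqa, ← Real.rpow_mul_natCast hqb] at h'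
  have e1 : a * ((j + k : ℕ) : ℝ) = j := by rw [ha]; push_cast; field_simp
  have e2 : b * ((j + k : ℕ) : ℝ) = k := by rw [hb]; push_cast; field_simp
  rw [e1, e2, Real.rpow_natCast, Real.rpow_natCast, div_pow q, div_pow (1 - q), div_mul_div_comm,
    div_le_one (by positivity)] at h'
  exact h'

/-- At its worst parameter, de Moivre's expression is a product of factors `k ^ k / k !`, which
Stirling's lower bound for the factorial controls. -/
theorem mul_choose_mul_pow_le {n m : ℕ} (hm : m ≤ n) {q : ℝ} (h0 : 0 ≤ q) (h1 : q ≤ 1) :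
    m * n.choose m * q ^ m * (1 - q) ^ (n + 1 - m) ≤
      √(2 * (n + 1 : ℕ)) * Stirling.stirlingSeq (n + 1) / (4 * Real.pi) := by
  have hN : 0 < Stirling.stirlingSeq (n + 1) := Stirling.stirlingSeq'_pos n
  rcases Nat.eq_zero_or_pos m with rfl | hm0
  · simp; positivity
  obtain ⟨k, rfl⟩ := Nat.exists_eq_add_of_le hm
  have hpow := pow_mul_one_sub_pow_le h0 h1 hm0 (Nat.succ_pos k)
  have hm' : (0 : ℝ) < m := by exact_mod_cast hm0
  set K : ℝ := ((k + 1 : ℕ) : ℝ) with hK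
  have hK' : 0 < K := by positivity
  have hsum : ((m + k + 1 : ℕ) : ℝ) = m + K := by push_cast [hK]; ring
  have hfac : ∀ j : ℕ, √(2 * Real.pi) * √j * (j : ℝ) ^ j ≤ j.factorial * Real.exp j := by
    intro j
    have h := Stirling.le_factorial_stirling j
    rwa [div_pow, ← Real.exp_nat_mul, mul_one, Real.sqrt_mul (by positivity), ← mul_div_assoc,
      div_le_iff₀ (Real.exp_pos _)] at h
  have hprod := mul_le_mul (hfac m) (hfac (k + 1)) (by positivity) (by positivity)
  rw [← hK] at hprod
  -- This inequality is an equality at `m = K`, the case of success probability `1 / 2`.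
  have hgm : 2 * (√m * √K) ≤ m + K := by
    nlinarith [sq_nonneg (√(m : ℝ) - √K), Real.sq_sqrt hm'.le, Real.sq_sqrt hK'.le]
  have hmain : 4 * Real.pi * (m * K * ((m : ℝ) ^ m * K ^ (k + 1))) ≤
      (m + K) * (m.factorial * (k + 1).factorial * Real.exp (m + K)) := by
    have hmul := mul_le_mul hgm hprod (by positivity) (by positivity)
    have hs : √(2 * Real.pi) * √(2 * Real.pi) = 2 * Real.pi := Real.mul_self_sqrt (by positivity)
    have hsm : √(m : ℝ) * √m = m := Real.mul_self_sqrt hm'.le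
    have hsK : √K * √K = K := Real.mul_self_sqrt hK'.le
    rw [Real.exp_add]
    calc _ = 2 * (2 * Real.pi) * (m * K * ((m : ℝ) ^ m * K ^ (k + 1))) := by ring
      _ = 2 * (√(2 * Real.pi) * √(2 * Real.pi)) *
          (√(m : ℝ) * √m * (√K * √K) * ((m : ℝ) ^ m * K ^ (k + 1))) := by rw [hs, hsm, hsK]
      _ ≤ _ := by linarith
  have hstir : √(2 * (m + k + 1 : ℕ)) * Stirling.stirlingSeq (m + k + 1) =
      (m + k + 1).factorial * Real.exp (m + K) / (m + K) ^ (m + k + 1) := by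
    rw [Stirling.stirlingSeq, div_pow, ← Real.exp_nat_mul, mul_one, hsum]
    have : √(2 * (m + K)) ≠ 0 := by positivity
    field_simp
  have hchoose : ((m + k).choose m : ℝ) * ((m + K) * (m.factorial * (k + 1).factorial)) =
      K * (m + k + 1).factorial := by
    have h := Nat.add_choose_mul_factorial_mul_factorial m k
    rw [← Nat.choose_symm_add] at h
    rw [← hsum, hK, Nat.factorial_succ k, Nat.factorial_succ (m + k), ← h]
    push_cast
    ring
  rw [show m + k + 1 - m = k + 1 by omega, hstir]
  have hfm : (0 : ℝ) < m.factorial := by positivity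
  have hfk : (0 : ℝ) < (k + 1).factorial := by positivity
  have hfN : (0 : ℝ) < (m + k + 1).factorial := by positivity
  have hch : ((m + k).choose m : ℝ) =
      K * (m + k + 1).factorial / ((m + K) * (m.factorial * (k + 1).factorial)) := by
    rw [eq_div_iff (by positivity), hchoose]
  calc m * ((m + k).choose m : ℝ) * q ^ m * (1 - q) ^ (k + 1)
      = m * (m + k).choose m * (q ^ m * (1 - q) ^ (k + 1)) := by ring
    _ ≤ m * (m + k).choose m * ((m / (m + K)) ^ m * (K / (m + K)) ^ (k + 1)) := by gcongr
    _ = (m + k + 1).factorial / (m + K) ^ (m + k + 1) *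
        ((m * K * ((m : ℝ) ^ m * K ^ (k + 1))) /
          ((m + K) * (m.factorial * (k + 1).factorial))) := by
        rw [hch, div_pow, div_pow, add_assoc m k 1, pow_add (m + K)]
        field_simp
        ring
    _ ≤ (m + k + 1).factorial / (m + K) ^ (m + k + 1) * (Real.exp (m + K) / (4 * Real.pi)) := by
        refine mul_le_mul_of_nonneg_left ?_ (by positivity)
        rw [div_le_div_iff₀ (by positivity) (by positivity)]
        linarith
    _ = _ := by
        field_simp

/-- A bound, uniform in `q`, on the mean positive deviation of a binomial count with success
probability `q`. It is asymptotic to `√n / (2 √(2 π))`, the value at `q = 1 / 2`. -/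
theorem sum_binomial_posPart_le (n : ℕ) {q : ℝ} (h0 : 0 ≤ q) (h1 : q ≤ 1) :
    ∑ S : Finset (Fin n), q ^ S.card * (1 - q) ^ (n - S.card) * max (S.card - n * q) 0 ≤
      √(2 * (n + 1 : ℕ)) * Stirling.stirlingSeq (n + 1) / (4 * Real.pi) := by
  -- The positive part vanishes below `⌈n * q⌉₊` and can be dropped from there on.
  have hm : ⌈n * q⌉₊ ≤ n := Nat.ceil_le.2 (by nlinarith [(Nat.cast_nonneg n : (0:ℝ) ≤ n)])
  refine le_trans (le_of_eq ?_) (mul_choose_mul_pow_le hm h0 h1)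
  rw [← sum_Icc_binomial_deviation n q hm, ← Finset.powerset_univ,
    Finset.sum_powerset_apply_card
      (fun k => q ^ k * (1 - q) ^ (n - k) * max ((k : ℝ) - n * q) 0)]
  simp only [Finset.card_univ, Fintype.card_fin, nsmul_eq_mul]
  symm
  refine Finset.sum_subset_zero_on_sdiff (fun k hk => by simp at hk ⊢; omega) ?_ ?_
  · intro k hk
    simp only [Finset.mem_sdiff, Finset.mem_range, Finset.mem_Icc, not_and, not_le] at hk
    have hlt : k < ⌈n * q⌉₊ := by
      by_contra! h
      have := hk.2 h
      omega
    rw [max_eq_right (by linarith [Nat.lt_ceil.1 hlt])]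
    simp
  · intro k hk
    rw [max_eq_left (by linarith [Nat.ceil_le.1 (Finset.mem_Icc.1 hk).1])]

end MBT

/-! ### Surplus captured by a posted price -/

namespace MBT

instance : IsProbabilityMeasure uniformPrior :=
  inferInstanceAs (IsProbabilityMeasure (volume : Measure I))

theorem integral_unitInterval_coe (f : ℝ → ℝ) {s : Set ℝ} :
    ∫ v in ((↑) : I → ℝ) ⁻¹' s, f v = ∫ x in s ∩ Set.Icc 0 1, f x := by
  rw [measurePreserving_coe.setIntegral_preimage_emb measurableEmbedding_coe,
    Measure.restrict_restrict' measurableSet_Icc]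

theorem setIntegral_Ici_sub_half (t : I) :
    ∫ v in Set.Ici t, ((v : ℝ) - 1 / 2) = (1 - t) * (t / 2) := by
  have hset : Set.Ici t = ((↑) : I → ℝ) ⁻¹' Set.Ici (t : ℝ) := rfl
  have hinter : Set.Ici (t : ℝ) ∩ Set.Icc 0 1 = Set.Icc (t : ℝ) 1 := by
    ext x
    exact ⟨fun h => ⟨h.1, h.2.2⟩, fun h => ⟨h.1, t.2.1.trans h.1, h.2⟩⟩
  rw [hset, integral_unitInterval_coe (fun x => x - 1 / 2), hinter, integral_Icc_eq_integral_Ioc,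
    ← intervalIntegral.integral_of_le t.2.2, intervalIntegral.integral_sub (by simp) (by simp)]
  simp
  ring

theorem setIntegral_Iio_sub_half (t : I) :
    ∫ v in Set.Iio t, ((v : ℝ) - 1 / 2) = t * (-(1 - t) / 2) := by
  have hset : Set.Iio t = ((↑) : I → ℝ) ⁻¹' Set.Iio (t : ℝ) := rfl
  have hinter : Set.Iio (t : ℝ) ∩ Set.Icc 0 1 = Set.Ico 0 (t : ℝ) := by
    ext x
    exact ⟨fun h => ⟨h.2.1, h.1⟩, fun h => ⟨h.2, h.1, h.2.le.trans t.2.2⟩⟩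
  rw [hset, integral_unitInterval_coe (fun x => x - 1 / 2), hinter, integral_Ico_eq_integral_Ioc,
    ← intervalIntegral.integral_of_le t.2.1, intervalIntegral.integral_sub (by simp) (by simp)]
  simp
  ring

/-- The bid profiles in which exactly the buyers in `S` bid at least the price `t`. -/
def priceBox {n : ℕ} (t : I) (S : Finset (Fin n)) : Set (Fin n → I) :=
  Set.univ.pi fun i => if i ∈ S then Set.Ici t else Set.Iio t

variable {n : ℕ}

theorem mem_priceBox {t : I} {S : Finset (Fin n)} {b : Fin n → I} :
    b ∈ priceBox t S ↔ ∀ i, t ≤ b i ↔ i ∈ S := by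
  simp only [priceBox, Set.mem_univ_pi]
  refine forall_congr' fun i => ?_
  by_cases hi : i ∈ S <;> simp [hi]

theorem measurableSet_priceBox (t : I) (S : Finset (Fin n)) : MeasurableSet (priceBox t S) := by
  refine MeasurableSet.univ_pi fun i => ?_
  split_ifs
  exacts [measurableSet_Ici, measurableSet_Iio]

theorem iUnion_priceBox (t : I) : ⋃ S : Finset (Fin n), priceBox t S = Set.univ := by
  refine Set.eq_univ_of_forall fun b => Set.mem_iUnion.2 ⟨Finset.univ.filter fun i => t ≤ b i, ?_⟩
  simp [mem_priceBox]

theorem pairwise_disjoint_priceBox (t : I) :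
    Pairwise (Function.onFun Disjoint (priceBox (n := n) t)) := by
  refine fun S T hST => Set.disjoint_left.2 fun b hS hT => hST ?_
  ext i
  rw [← mem_priceBox.1 hS i, mem_priceBox.1 hT i]

theorem integrable_pi_of_bounded {f : (Fin n → I) → ℝ} (hf : Measurable f) {C : ℝ}
    (hC : ∀ b, |f b| ≤ C) (μ : Measure (Fin n → I)) [IsFiniteMeasure μ] : Integrable f μ :=
  Integrable.of_bound hf.aestronglyMeasurable C (ae_of_all _ hC)

/-- Under the uniform prior, `(1 - t) ^ |S| * t ^ (n - |S|)` is the probability of the box, and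
`(|S| - n * (1 - t)) / 2` is the conditional mean of the surplus given the box. -/
theorem setIntegral_priceBox (t : I) (S : Finset (Fin n)) :
    ∫ b in priceBox t S, ∑ i, ((b i : ℝ) - 1 / 2) ∂(Measure.pi fun _ : Fin n => uniformPrior) =
      (1 - t : ℝ) ^ S.card * (t : ℝ) ^ (n - S.card) * ((S.card - n * (1 - t)) / 2) := by
  have hterm : ∀ i : Fin n, ∫ b in priceBox t S, ((b i : ℝ) - 1 / 2)
      ∂(Measure.pi fun _ : Fin n => uniformPrior) =
      (1 - t : ℝ) ^ S.card * (t : ℝ) ^ (n - S.card) *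
        (if i ∈ S then (t : ℝ) / 2 else -(1 - t) / 2) := by
    intro i
    rw [priceBox, Measure.restrict_pi_pi]
    have h := integral_fintype_prod_eq_prod (𝕜 := ℝ) (E := fun _ : Fin n => I)
      (fun j v => if j = i then (v : ℝ) - 1 / 2 else 1)
      (μ := fun j => uniformPrior.restrict (if j ∈ S then Set.Ici t else Set.Iio t))
    have hfac : ∀ j : Fin n, ∫ v, (if j = i then (v : ℝ) - 1 / 2 else 1)
        ∂uniformPrior.restrict (if j ∈ S then Set.Ici t else Set.Iio t) =
        (if j ∈ S then (1 - t : ℝ) else t) *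
          (if j = i then if i ∈ S then (t : ℝ) / 2 else -(1 - t) / 2 else 1) := by
      intro j
      by_cases hji : j = i
      · subst hji
        by_cases hj : j ∈ S
        · simpa [hj, uniformPrior] using setIntegral_Ici_sub_half t
        · simpa [hj, uniformPrior] using setIntegral_Iio_sub_half t
      · have h1 : (0 : ℝ) ≤ 1 - t := sub_nonneg.2 t.2.2
        by_cases hj : j ∈ S <;> simp [hj, hji, uniformPrior, Measure.real, h1, t.2.1]
    simp only [Finset.prod_ite_eq', Finset.mem_univ, if_true] at h
    rw [h]
    simp only [hfac, Finset.prod_mul_distrib, Finset.prod_ite_eq', Finset.mem_univ, if_true]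
    simp [Finset.prod_ite, Finset.filter_not, Finset.card_sdiff]
  rw [integral_finsetSum _ fun i _ => integrable_pi_of_bounded (C := 1) (by fun_prop)
    (fun b => abs_le.2 ⟨by linarith [(b i).2.1], by linarith [(b i).2.2]⟩) _]
  rw [Finset.sum_congr rfl fun i _ => hterm i, ← Finset.mul_sum]
  congr 1
  simp [Finset.sum_ite, Finset.filter_not, Finset.card_sdiff]
  rw [Nat.cast_sub (by simpa using Finset.card_le_univ S)]
  ring

theorem exists_eq_on_priceBox {t : I} {h : (Fin n → I) → ℝ} (h0 : ∀ b, 0 ≤ h b)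
    (h1 : ∀ b, h b ≤ 1) (ht : ∀ b b' : Fin n → I, (∀ i, t ≤ b i ↔ t ≤ b' i) → h b = h b') :
    ∃ y : Finset (Fin n) → ℝ, ∀ S, 0 ≤ y S ∧ y S ≤ 1 ∧ ∀ b ∈ priceBox t S, h b = y S := by
  suffices hex : ∀ S, ∃ y : ℝ, 0 ≤ y ∧ y ≤ 1 ∧ ∀ b ∈ priceBox t S, h b = y by
    choose y hy using hex
    exact ⟨y, hy⟩
  intro S
  by_cases hne : (priceBox t S).Nonempty
  · obtain ⟨c, hc⟩ := hne
    exact ⟨h c, h0 c, h1 c,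
      fun b hb => ht b c fun i => (mem_priceBox.1 hb i).trans (mem_priceBox.1 hc i).symm⟩
  · exact ⟨0, le_rfl, zero_le_one, fun b hb => (hne ⟨b, hb⟩).elim⟩

theorem measurable_of_eq_on_priceBox {t : I} {h : (Fin n → I) → ℝ} {y : Finset (Fin n) → ℝ}
    (hy : ∀ S, ∀ b ∈ priceBox t S, h b = y S) : Measurable h := by
  intro A _
  have : h ⁻¹' A = ⋃ S, ⋃ (_ : y S ∈ A), priceBox t S := by
    ext b
    obtain ⟨S, hS⟩ := Set.mem_iUnion.1 ((iUnion_priceBox (n := n) t).symm ▸ Set.mem_univ b)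
    simp only [Set.mem_preimage, Set.mem_iUnion, exists_prop]
    constructor
    · exact fun hb => ⟨S, hy S b hS ▸ hb, hS⟩
    · rintro ⟨T, hT, hbT⟩
      exact hy T b hbT ▸ hT
  rw [this]
  exact MeasurableSet.iUnion fun S => MeasurableSet.iUnion fun _ => measurableSet_priceBox t S

theorem abs_sum_sub_half_le (b : Fin n → I) : |∑ i, ((b i : ℝ) - 1 / 2)| ≤ n := by
  refine (Finset.abs_sum_le_sum_abs _ _).trans ?_
  refine (Finset.sum_le_card_nsmul _ _ 1 fun i _ => ?_).trans (by simp)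
  exact abs_le.2 ⟨by linarith [(b i).2.1], by linarith [(b i).2.2]⟩

theorem integrable_sum_sub_half_mul {h : (Fin n → I) → ℝ} (hm : Measurable h)
    (h0 : ∀ b, 0 ≤ h b) (h1 : ∀ b, h b ≤ 1) :
    Integrable (fun b => (∑ i, ((b i : ℝ) - 1 / 2)) * h b)
      (Measure.pi fun _ : Fin n => uniformPrior) := by
  refine integrable_pi_of_bounded (C := n) (by fun_prop) (fun b => ?_) _
  rw [abs_mul, abs_of_nonneg (h0 b)]
  exact (mul_le_of_le_one_right (abs_nonneg _) (h1 b)).trans (abs_sum_sub_half_le b)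

/-- An allocation that depends only on which bids reach a price `t` extracts at most the positive
part of the conditional mean surplus given that information. -/
theorem integral_sum_sub_half_mul_le {t : I} {h : (Fin n → I) → ℝ} (h0 : ∀ b, 0 ≤ h b)
    (h1 : ∀ b, h b ≤ 1) (ht : ∀ b b' : Fin n → I, (∀ i, t ≤ b i ↔ t ≤ b' i) → h b = h b') :
    ∫ b, (∑ i, ((b i : ℝ) - 1 / 2)) * h b ∂(Measure.pi fun _ : Fin n => uniformPrior) ≤
      √(2 * (n + 1 : ℕ)) * Stirling.stirlingSeq (n + 1) / (8 * Real.pi) := by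
  obtain ⟨y, hy⟩ := exists_eq_on_priceBox h0 h1 ht
  have hint := integrable_sum_sub_half_mul
    (measurable_of_eq_on_priceBox fun S => (hy S).2.2) h0 h1
  rw [← setIntegral_univ, ← iUnion_priceBox t,
    integral_iUnion_fintype (measurableSet_priceBox t) (pairwise_disjoint_priceBox t)
      fun S => hint.integrableOn]
  have hq0 : (0 : ℝ) ≤ 1 - t := sub_nonneg.2 t.2.2
  have hbin := sum_binomial_posPart_le n hq0 (sub_le_self 1 t.2.1)
  rw [sub_sub_cancel] at hbin
  calc _ ≤ ∑ S : Finset (Fin n), (1 - t : ℝ) ^ S.card * (t : ℝ) ^ (n - S.card) *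
        max (S.card - n * (1 - t : ℝ)) 0 / 2 := by
        refine Finset.sum_le_sum fun S _ => ?_
        rw [setIntegral_congr_fun (measurableSet_priceBox t S)
          (g := fun b => (∑ i, ((b i : ℝ) - 1 / 2)) * y S)
          (fun b hb => by simp only [(hy S).2.2 b hb]), integral_mul_const, setIntegral_priceBox]
        have hw : 0 ≤ (1 - t : ℝ) ^ S.card * (t : ℝ) ^ (n - S.card) :=
          mul_nonneg (pow_nonneg hq0 _) (pow_nonneg t.2.1 _)
        rw [mul_assoc, mul_div_assoc]
        refine mul_le_mul_of_nonneg_left ?_ hw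
        obtain ⟨hy0, hy1, -⟩ := hy S
        calc _ ≤ max (S.card - n * (1 - t : ℝ)) 0 / 2 * y S :=
              mul_le_mul_of_nonneg_right (by gcongr; exact le_max_left _ _) hy0
          _ ≤ _ := mul_le_of_le_one_right (by positivity) hy1
    _ ≤ _ := by
        rw [← Finset.sum_div]
        calc _ ≤ _ := div_le_div_of_nonneg_right hbin zero_le_two
          _ = _ := by ring

end MBT

/-! ### Expected gains when every cost is `1 / 2` -/

namespace MBT

variable {n : ℕ}

/-- The ask profile in which every seller asks `1 / 2`. -/
noncomputable def halfAsks (n : ℕ) : Fin n → I := fun _ => ⟨1 / 2, by norm_num, by norm_num⟩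

instance : IsProbabilityMeasure halfPrior :=
  inferInstanceAs (IsProbabilityMeasure (Measure.dirac _))

theorem pi_halfPrior (n : ℕ) :
    (Measure.pi fun _ : Fin n => halfPrior) = Measure.dirac (halfAsks n) := by
  refine Measure.pi_eq fun s hs => ?_
  rw [Measure.dirac_apply' _ (MeasurableSet.univ_pi hs)]
  simp only [halfPrior, Measure.dirac_apply' _ (hs _)]
  by_cases h : ∀ i, halfAsks n i ∈ s i
  · rw [Set.indicator_of_mem (by simpa using h)]
    symm
    exact Finset.prod_eq_one fun i _ => Set.indicator_of_mem (h i) _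
  · rw [Set.indicator_of_notMem (by simpa using h)]
    push Not at h
    obtain ⟨i, hi⟩ := h
    exact (Finset.prod_eq_zero (Finset.mem_univ i) (Set.indicator_of_notMem hi _)).symm

theorem jointLaw_uniform_half (n : ℕ) :
    jointLaw uniformPrior halfPrior n =
      (Measure.pi fun _ : Fin n => uniformPrior).map fun b => (b, halfAsks n) := by
  rw [jointLaw, pi_halfPrior, Measure.prod_dirac]

/-- Integrals over the joint law see only the section at `halfAsks n`. No measurability of `f` is
needed, because the section map is a measurable embedding. -/
theorem integral_jointLaw (f : (Fin n → I) × (Fin n → I) → ℝ) :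
    ∫ w, f w ∂jointLaw uniformPrior halfPrior n =
      ∫ b, f (b, halfAsks n) ∂(Measure.pi fun _ : Fin n => uniformPrior) := by
  rw [jointLaw_uniform_half, (measurableEmbedding_prod_mk_right _).integral_map]

theorem integrable_jointLaw_iff (f : (Fin n → I) × (Fin n → I) → ℝ) :
    Integrable f (jointLaw uniformPrior halfPrior n) ↔
      Integrable (fun b => f (b, halfAsks n)) (Measure.pi fun _ : Fin n => uniformPrior) := by
  rw [jointLaw_uniform_half, (measurableEmbedding_prod_mk_right _).integrable_map_iff]
  rfl

theorem surplus_halfAsks (b : Fin n → I) :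
    surplus b (halfAsks n) = ∑ i, ((b i : ℝ) - 1 / 2) := by
  simp [surplus, halfAsks]

theorem firstBest_eq (n : ℕ) :
    firstBest uniformPrior halfPrior n =
      ∫ b, max (∑ i, ((b i : ℝ) - 1 / 2)) 0 ∂(Measure.pi fun _ : Fin n => uniformPrior) := by
  rw [firstBest, integral_jointLaw]
  refine integral_congr_ae (ae_of_all _ fun b => ?_)
  have hs := surplus_halfAsks b
  simp only [hs]
  rw [surplus] at hs
  split_ifs with h
  · rw [mul_one, max_eq_left (by linarith)]
  · rw [mul_zero, max_eq_right (by linarith)]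

theorem integrable_posPart_sum (n : ℕ) :
    Integrable (fun b : Fin n → I => max (∑ i, ((b i : ℝ) - 1 / 2)) 0)
      (Measure.pi fun _ : Fin n => uniformPrior) :=
  integrable_pi_of_bounded (C := n) (by fun_prop)
    (fun b => by
      rw [abs_of_nonneg (le_max_right _ _)]
      exact max_le ((le_abs_self _).trans (abs_sum_sub_half_le b)) n.cast_nonneg) _

theorem firstBest_pos (hn : 1 ≤ n) : 0 < firstBest uniformPrior halfPrior n := by
  -- It suffices to count the profiles in which every value is at least `1 / 2`.
  let t : I := ⟨1 / 2, by norm_num, by norm_num⟩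
  have hn' : (0 : ℝ) < n := by exact_mod_cast hn
  have hbox := setIntegral_priceBox t (Finset.univ : Finset (Fin n))
  have ht : (t : ℝ) = 1 / 2 := rfl
  rw [firstBest_eq]
  calc (0 : ℝ) < ∫ b in priceBox t Finset.univ, ∑ i, ((b i : ℝ) - 1 / 2)
        ∂(Measure.pi fun _ : Fin n => uniformPrior) := by
        rw [hbox, ht, Finset.card_univ, Fintype.card_fin, Nat.sub_self]
        have : (n : ℝ) - n * (1 - 1 / 2) = n / 2 := by ring
        rw [this]
        positivity
    _ ≤ ∫ b in priceBox t Finset.univ, max (∑ i, ((b i : ℝ) - 1 / 2)) 0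
        ∂(Measure.pi fun _ : Fin n => uniformPrior) :=
        integral_mono (integrable_pi_of_bounded (by fun_prop) abs_sum_sub_half_le _)
          (integrable_posPart_sum n).integrableOn fun b => le_max_left _ _
    _ ≤ _ := setIntegral_le_integral (integrable_posPart_sum n)
        (ae_of_all _ fun b => le_max_right _ _)

theorem Mechanism.gain_halfAsks (M : Mechanism n) (b : Fin n → I) :
    M.gain (b, halfAsks n) = (∑ i, ((b i : ℝ) - 1 / 2)) * M.x b (halfAsks n) := by
  rw [Mechanism.gain, surplus_halfAsks]

theorem Mechanism.IsIC.integrable_gain {M : Mechanism n} (hIC : M.IsIC)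
    (hdet : M.IsDeterministic) : Integrable M.gain (jointLaw uniformPrior halfPrior n) := by
  obtain ⟨t, ht⟩ := hIC.exists_price hdet (halfAsks n)
  obtain ⟨y, hy⟩ := exists_eq_on_priceBox (fun b => M.x_nonneg b _) (fun b => M.x_le_one b _) ht
  rw [integrable_jointLaw_iff]
  simp only [M.gain_halfAsks]
  exact integrable_sum_sub_half_mul (measurable_of_eq_on_priceBox fun S => (hy S).2.2)
    (fun b => M.x_nonneg b _) (fun b => M.x_le_one b _)

theorem Mechanism.IsIC.gft_le {M : Mechanism n} (hIC : M.IsIC) (hdet : M.IsDeterministic) :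
    M.gft uniformPrior halfPrior ≤
      √(2 * (n + 1 : ℕ)) * Stirling.stirlingSeq (n + 1) / (8 * Real.pi) := by
  obtain ⟨t, ht⟩ := hIC.exists_price hdet (halfAsks n)
  rw [Mechanism.gft, integral_jointLaw]
  simp only [M.gain_halfAsks]
  exact integral_sum_sub_half_mul_le (fun b => M.x_nonneg b _) (fun b => M.x_le_one b _) ht

theorem mean_uniformPrior : mean uniformPrior = 1 / 2 := by
  have h := integral_unitInterval_coe (fun x => x) (s := Set.univ)
  rw [Set.univ_inter, integral_Icc_eq_integral_Ioc, ← intervalIntegral.integral_of_le zero_le_one,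
    integral_id] at h
  simpa [mean, uniformPrior] using h

theorem mean_halfPrior : mean halfPrior = 1 / 2 := by
  simp [mean, halfPrior]

end MBT

/-! ### Growth of the first best -/

namespace MBT

open ProbabilityTheory

theorem integral_Ioi_mul_exp_neg_mul_sq {c : ℝ} (hc : 0 < c) :
    ∫ x in Set.Ioi (0 : ℝ), x * Real.exp (-c * x ^ 2) = 1 / (2 * c) := by
  have h := integral_rpow_mul_exp_neg_mul_rpow (p := 2) (q := 1) (b := c) (by norm_num)
    (by norm_num) hc
  simp only [Real.rpow_one, Real.rpow_two] at h
  rw [h]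
  norm_num [Real.Gamma_one, Real.rpow_neg_one]

theorem integral_posPart_gaussianReal {v : NNReal} (hv : v ≠ 0) :
    ∫ x, max x 0 ∂gaussianReal 0 v = √(v / (2 * Real.pi)) := by
  have hv' : (0 : ℝ) < v := by exact_mod_cast pos_iff_ne_zero.2 hv
  rw [integral_gaussianReal_eq_integral_smul hv]
  have : ∀ x : ℝ, gaussianPDFReal 0 v x • max x 0 = (Set.Ioi (0 : ℝ)).indicator
      (fun x => (√(2 * Real.pi * v))⁻¹ * (x * Real.exp (-(1 / (2 * v)) * x ^ 2))) x := by
    intro x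
    rcases le_or_gt x 0 with hx | hx
    · simp [hx]
    · rw [Set.indicator_of_mem (Set.mem_Ioi.2 hx), max_eq_left hx.le, gaussianPDFReal_def,
        smul_eq_mul]
      simp only [sub_zero]
      rw [show -(1 / (2 * (v : ℝ))) * x ^ 2 = -x ^ 2 / (2 * v) by ring]
      ring
  simp only [this]
  rw [integral_indicator measurableSet_Ioi, integral_const_mul,
    integral_Ioi_mul_exp_neg_mul_sq (by positivity)]
  have h1 : √(2 * Real.pi * v) = √(2 * Real.pi) * √v := Real.sqrt_mul (by positivity) _
  rw [h1, Real.sqrt_div hv'.le]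
  have : √(v : ℝ) * √v = v := Real.mul_self_sqrt hv'.le
  field_simp
  linarith

theorem integral_uniformPrior_sub_half : ∫ v : I, ((v : ℝ) - 1 / 2) = 0 := by
  have h := integral_unitInterval_coe (fun x => x - 1 / 2) (s := Set.univ)
  rw [Set.univ_inter, integral_Icc_eq_integral_Ioc, ← intervalIntegral.integral_of_le zero_le_one,
    intervalIntegral.integral_sub (by simp) (by simp), integral_id] at h
  simpa using h

theorem integral_sub_half_sq : ∫ v : I, ((v : ℝ) - 1 / 2) ^ 2 = 1 / 12 := by
  have h := integral_unitInterval_coe (fun x => (x - 1 / 2) ^ 2) (s := Set.univ)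
  rw [Set.univ_inter, integral_Icc_eq_integral_Ioc, ← intervalIntegral.integral_of_le zero_le_one,
    intervalIntegral.integral_comp_sub_right (fun x => x ^ 2), integral_pow] at h
  rw [Set.preimage_univ, Measure.restrict_univ] at h
  rw [h]
  norm_num

/-- The law of an infinite i.i.d. sequence of uniform values. -/
noncomputable def valueSeq : Measure (ℕ → I) := Measure.infinitePi fun _ => uniformPrior

instance : IsProbabilityMeasure valueSeq :=
  inferInstanceAs (IsProbabilityMeasure (Measure.infinitePi _))

theorem measurePreserving_eval_valueSeq (k : ℕ) :
    MeasurePreserving (fun ω : ℕ → I => ω k) valueSeq uniformPrior :=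
  measurePreserving_eval_infinitePi (fun _ : ℕ => uniformPrior) k

theorem map_valueSeq (n : ℕ) :
    valueSeq.map (fun ω (i : Fin n) => ω i) = Measure.pi fun _ : Fin n => uniformPrior := by
  have hind : iIndepFun (fun (i : ℕ) (ω : ℕ → I) => ω i) valueSeq :=
    iIndepFun_infinitePi (P := fun _ : ℕ => uniformPrior) (X := fun _ v => v)
      fun _ => measurable_id
  rw [(iIndepFun_iff_map_fun_eq_pi_map fun i => (measurable_pi_apply _).aemeasurable).1
    (hind.precomp (Fin.val_injective (n := n)))]
  congr 1
  funext i
  exact (measurePreserving_eval_valueSeq i).map_eq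

/-- The central limit theorem for uniform values. -/
theorem tendstoInDistribution_valueSeq :
    TendstoInDistribution
      (fun (n : ℕ) (ω : ℕ → I) => (√n)⁻¹ * ∑ k ∈ Finset.range n, ((ω k : ℝ) - 1 / 2)) atTop
      (id : ℝ → ℝ) (fun _ => valueSeq) (gaussianReal 0 (1 / 12)) := by
  have hX : Measurable fun v : I => (v : ℝ) - 1 / 2 := by fun_prop
  have hX0 : ∀ k, Measurable fun ω : ℕ → I => (ω k : ℝ) - 1 / 2 := fun k => by fun_prop
  have hmean : ∫ ω, ((ω 0 : ℝ) - 1 / 2) ∂valueSeq = 0 := by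
    rw [← integral_uniformPrior_sub_half]
    exact ((measurePreserving_eval_valueSeq 0).hasLaw).integral_comp hX.aestronglyMeasurable
  have hvar : Var[fun ω : ℕ → I => (ω 0 : ℝ) - 1 / 2; valueSeq] = 1 / 12 := by
    rw [variance_of_integral_eq_zero (hX0 0).aemeasurable hmean, ← integral_sub_half_sq]
    exact ((measurePreserving_eval_valueSeq 0).hasLaw).integral_comp
      (hX.pow_const 2).aestronglyMeasurable
  have h := tendstoInDistribution_inv_sqrt_mul_sum_sub (P := valueSeq)
    (P' := gaussianReal 0 (1 / 12)) (Y := id)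
    (X := fun k ω => (ω k : ℝ) - 1 / 2)
    (by
      rw [hvar, show ((1 / 12 : ℝ)).toNNReal = 1 / 12 by
        rw [Real.toNNReal_div zero_le_one]; norm_num]
      exact HasLaw.id)
    (MemLp.of_bound (hX0 0).aestronglyMeasurable 1 (ae_of_all _ fun ω => abs_le.2
      ⟨by linarith [(ω 0).2.1], by linarith [(ω 0).2.2]⟩))
    (iIndepFun_infinitePi (P := fun _ : ℕ => uniformPrior) fun _ => hX)
    (fun i => by
      have hk := fun k => (measurePreserving_eval_valueSeq k).hasLaw
      exact (IdentDistrib.mk (hk i).aemeasurable (hk 0).aemeasurable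
        ((hk i).map_eq.trans (hk 0).map_eq.symm)).comp hX)
  simpa only [hmean, mul_zero, sub_zero] using h

theorem lintegral_valueSeq (n : ℕ) :
    ∫⁻ ω, ENNReal.ofReal (max ((√n)⁻¹ * ∑ k ∈ Finset.range n, ((ω k : ℝ) - 1 / 2)) 0) ∂valueSeq =
      ENNReal.ofReal ((√n)⁻¹ * firstBest uniformPrior halfPrior n) := by
  have hmul : ∀ s : ℝ, max ((√n)⁻¹ * s) 0 = (√n)⁻¹ * max s 0 := fun s => by
    rw [mul_max_of_nonneg _ _ (by positivity), mul_zero]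
  rw [firstBest_eq, ← integral_const_mul, ofReal_integral_eq_lintegral_ofReal
    ((integrable_posPart_sum n).const_mul _) (ae_of_all _ fun b => by positivity),
    ← map_valueSeq, lintegral_map (by fun_prop) (by fun_prop)]
  refine lintegral_congr fun ω => ?_
  rw [hmul, Fin.sum_univ_eq_sum_range (fun k => (ω k : ℝ) - 1 / 2) n]

/-- The first best grows at least like `√(n / (24 π))`. Weak convergence gives this lower bound
directly, since the positive part is continuous and nonnegative; no uniform integrability is
needed. -/
theorem eventually_lt_firstBest {β : ℝ} (hβ0 : 0 ≤ β) (hβ : β < √(1 / (24 * Real.pi))) :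
    ∀ᶠ n : ℕ in atTop, β * √n < firstBest uniformPrior halfPrior n := by
  have hclt := tendstoInDistribution_valueSeq
  have hle := lintegral_le_liminf_lintegral_of_forall_isOpen_measure_le_liminf_measure
    (f := fun x : ℝ => max x 0) (by fun_prop) (fun x => le_max_right _ _)
    (fun G hG => ProbabilityMeasure.le_liminf_measure_open_of_tendsto hclt.tendsto hG)
  have hint : Integrable (fun x : ℝ => max x 0) (gaussianReal 0 (1 / 12)) := by
    have := (memLp_id_gaussianReal (μ := 0) (v := 1 / 12) 1).integrable (by norm_num)
    exact this.pos_part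
  have hgauss : ENNReal.ofReal β <
      ∫⁻ x, ENNReal.ofReal (max x 0) ∂(gaussianReal 0 (1 / 12)) := by
    rw [← ofReal_integral_eq_lintegral_ofReal hint (ae_of_all _ fun x => le_max_right _ _),
      integral_posPart_gaussianReal (by norm_num), ENNReal.ofReal_lt_ofReal_iff_of_nonneg hβ0]
    refine hβ.trans_eq (congrArg _ ?_)
    push_cast
    ring
  simp only [ProbabilityMeasure.coe_mk, Measure.map_id] at hle
  filter_upwards [eventually_lt_of_lt_liminf (hgauss.trans_le hle), eventually_gt_atTop 0]
    with n hn hn0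
  rw [lintegral_map (by fun_prop) (by fun_prop), lintegral_valueSeq,
    ENNReal.ofReal_lt_ofReal_iff_of_nonneg hβ0, inv_mul_eq_div, lt_div_iff₀ (by positivity)] at hn
  exact hn

theorem tendsto_gft_bound :
    Tendsto (fun n : ℕ => √(2 * (n + 1 : ℕ)) * Stirling.stirlingSeq (n + 1) / (8 * Real.pi) / √n)
      atTop (𝓝 (√3 / 2 * √(1 / (24 * Real.pi)))) := by
  have h1 := Stirling.tendsto_stirlingSeq_sqrt_pi.comp (tendsto_add_atTop_nat 1)
  have h2 : Tendsto (fun n : ℕ => √(1 + 1 / (n : ℝ))) atTop (𝓝 1) := by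
    simpa using (tendsto_one_div_atTop_nhds_zero_nat (𝕜 := ℝ)).const_add 1 |>.sqrt
  have h3 := ((h2.mul h1).mul_const (√2 / (8 * Real.pi)))
  have hlim : 1 * √Real.pi * (√2 / (8 * Real.pi)) = √3 / 2 * √(1 / (24 * Real.pi)) := by
    have hpi := Real.pi_pos
    rw [← sq_eq_sq₀ (by positivity) (by positivity)]
    simp only [mul_pow, div_pow]
    rw [Real.sq_sqrt hpi.le, Real.sq_sqrt (by positivity), Real.sq_sqrt (by positivity),
      Real.sq_sqrt (by positivity)]
    field_simp
    norm_num
  rw [← hlim]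
  refine h3.congr' ?_
  filter_upwards [eventually_gt_atTop 0] with n hn
  have hn' : (0 : ℝ) < n := by exact_mod_cast hn
  have hs : √(1 + 1 / (n : ℝ)) = √((n + 1 : ℕ) : ℝ) / √n := by
    rw [← Real.sqrt_div (by positivity)]
    congr 1
    push_cast
    field_simp
  have h22 : √(2 * ((n + 1 : ℕ) : ℝ)) = √2 * √((n + 1 : ℕ) : ℝ) := Real.sqrt_mul (by norm_num) _
  simp only [hs, h22, Function.comp]
  field_simp

theorem gft_div_firstBest_le {ε : ℝ} (hε : 0 < ε) : ∃ N : ℕ, ∀ n : ℕ, N ≤ n →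
    ∀ M : Mechanism n, M.IsDeterministic → M.IsIC →
      M.gft uniformPrior halfPrior / firstBest uniformPrior halfPrior n ≤ √3 / 2 + ε := by
  have hB : 0 < √(1 / (24 * Real.pi)) := by positivity
  have h3 : (0 : ℝ) < √3 / 2 := by positivity
  -- Halving the slack leaves room on both sides of the comparison.
  set β : ℝ := (√3 / 2 + ε / 2) / (√3 / 2 + ε) * √(1 / (24 * Real.pi)) with hβ
  have hβ0 : 0 ≤ β := by positivity
  have hβB : β < √(1 / (24 * Real.pi)) :=
    mul_lt_of_lt_one_left hB ((div_lt_one (by positivity)).2 (by linarith))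
  have hβε : √3 / 2 * √(1 / (24 * Real.pi)) < (√3 / 2 + ε) * β := by
    rw [hβ, ← mul_assoc, mul_div_cancel₀ _ (by positivity)]
    exact mul_lt_mul_of_pos_right (by linarith) hB
  obtain ⟨N, hN⟩ := eventually_atTop.1 ((eventually_lt_firstBest hβ0 hβB).and
    ((tendsto_gft_bound.eventually_lt_const hβε).and (eventually_ge_atTop 1)))
  refine ⟨N, fun n hn M hdet hIC => ?_⟩
  obtain ⟨hfb, hgft, hn1⟩ := hN n hn
  have hn0 : (0 : ℝ) < n := by exact_mod_cast hn1
  rw [div_lt_iff₀ (by positivity)] at hgft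
  rw [div_le_iff₀ (firstBest_pos hn1)]
  calc M.gft uniformPrior halfPrior ≤ _ := hIC.gft_le hdet
    _ ≤ (√3 / 2 + ε) * (β * √n) := by rw [← mul_assoc]; exact hgft.le
    _ ≤ _ := by gcongr

theorem not_efficientInLimit (M : (n : ℕ) → Mechanism n)
    (hM : ∀ n, (M n).IsDeterministic ∧ (M n).IsIC) :
    ¬ EfficientInLimit uniformPrior halfPrior M := by
  intro h
  have hlt : √3 / 2 < 1 := by
    rw [div_lt_one (by norm_num), Real.sqrt_lt' (by norm_num)]
    norm_num
  obtain ⟨N, hN⟩ := gft_div_firstBest_le (ε := (1 - √3 / 2) / 2) (by linarith)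
  have hle := le_of_tendsto h (eventually_atTop.2
    ⟨N, fun n hn => hN n hn (M n) (hM n).1 (hM n).2⟩)
  linarith

end MBT

theorem mainTheorem3 :
    -- there are priors with mean value at most mean cost, and positive first best, for which no
    -- deterministic IC mechanism is efficient in the limit
    (∃ F G : Measure I, IsProbabilityMeasure F ∧ IsProbabilityMeasure G ∧
      MBT.mean F ≤ MBT.mean G ∧ (∀ n : ℕ, 1 ≤ n → 0 < MBT.firstBest F G n) ∧
      ∀ M : (n : ℕ) → MBT.Mechanism n,
        (∀ n, (M n).IsDeterministic ∧ (M n).IsIC) → ¬ MBT.EfficientInLimit F G M) ∧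
    -- the uniform prior and the point mass at 1/2 are such priors, with the bound √3/2 + o(1),
    -- where the o(1) depends only on n
    (IsProbabilityMeasure MBT.uniformPrior ∧ IsProbabilityMeasure MBT.halfPrior ∧
      MBT.mean MBT.uniformPrior = 1 / 2 ∧ MBT.mean MBT.halfPrior = 1 / 2 ∧
      (∀ n : ℕ, 1 ≤ n → 0 < MBT.firstBest MBT.uniformPrior MBT.halfPrior n) ∧
      (∀ (n : ℕ) (M : MBT.Mechanism n), M.IsDeterministic → M.IsIC →
        Integrable M.gain (MBT.jointLaw MBT.uniformPrior MBT.halfPrior n)) ∧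
      (∀ ε : ℝ, 0 < ε → ∃ N : ℕ, ∀ n : ℕ, N ≤ n →
        ∀ M : MBT.Mechanism n, M.IsDeterministic → M.IsIC →
          M.gft MBT.uniformPrior MBT.halfPrior / MBT.firstBest MBT.uniformPrior MBT.halfPrior n
            ≤ Real.sqrt 3 / 2 + ε) ∧
      (∀ M : (n : ℕ) → MBT.Mechanism n, (∀ n, (M n).IsDeterministic ∧ (M n).IsIC) →
        ¬ MBT.EfficientInLimit MBT.uniformPrior MBT.halfPrior M)) := by
  have hfb : ∀ n : ℕ, 1 ≤ n → 0 < MBT.firstBest MBT.uniformPrior MBT.halfPrior n :=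
    fun n hn => MBT.firstBest_pos hn
  refine ⟨⟨MBT.uniformPrior, MBT.halfPrior, inferInstance, inferInstance, ?_, hfb,
    MBT.not_efficientInLimit⟩, inferInstance, inferInstance, MBT.mean_uniformPrior,
    MBT.mean_halfPrior, hfb, fun n M hdet hIC => hIC.integrable_gain hdet,
    fun ε hε => MBT.gft_div_firstBest_le hε, MBT.not_efficientInLimit⟩
  rw [MBT.mean_uniformPrior, MBT.mean_halfPrior]
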